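/- Let $X$ be a (real or complex) Banach space with dual $X^*$, and let $(x_k)_{k\ge 1}$ be a sequence in $X$ which is convex shift-bounded, i.e. there is a constant $c>0$ such that $$\Big\|\sum_{j=1}^p\lambda_j x_{j+k}\Big\|\le c\,\Big\|\sum_{j=1}^p\lambda_j x_j\Big\|$$ for all integers $k\ge 1$, $p\ge 1$ and all real $\lambda_1,\dots,\lambda_p\ge 0$. Then the following conditions are equivalent: (i) $(x_k)_{k\ge 1}$ is weakly mixing to zero, that is, $$\lim_{n\to\infty}\frac1n\sum_{k=1}^n|\langle x^*,x_k\rangle|=0\quad\text{for all }x^*\in X^*;$$ (ii) $(x_k)_{k\ge 1}$ is uniformly weakly mixing to zero, that is, $$\lim_{n\to\infty}\ \sup\Big\{\frac1n\sum_{k=1}^n|\langle x^*,x_k\rangle| : x^*\in X^*,\ \|x^*\|\le 1\Big\}=0;$$ (iii) $$\lim_{\substack{a,b\ge 1\\ b-a\to\infty}}\ \sup\Big\{\frac1{b-a+1}\sum_{k=a}^b|\langle x^*,x_k\rangle| : x^*\in X^*,\ \|x^*\|\le 1\Big\}=0,$$ where $a,b$ run over the positive integers. -/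

import Mathlib

open Filter Topology

noncomputable section

/-! Sequences `(x_k)_{k ≥ 1}` are functions `x : ℕ → X` of which only the values `x k` with
`1 ≤ k` are ever used. The scalar field `𝕜` is `ℝ` or `ℂ`. -/

/-- `(x_k)_{k ≥ 1}` is convex shift-bounded: there is `c > 0` such that
`‖∑_{j=1}^p λ_j x_{j+k}‖ ≤ c ‖∑_{j=1}^p λ_j x_j‖` for all `k ≥ 1`, `p ≥ 1` and all real
`λ_1, …, λ_p ≥ 0`. -/
def ConvexShiftBounded (𝕜 : Type*) {X : Type*} [RCLike 𝕜] [NormedAddCommGroup X]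
    [NormedSpace 𝕜 X] (x : ℕ → X) : Prop :=
  ∃ c : ℝ, 0 < c ∧ ∀ p : ℕ, 1 ≤ p → ∀ lam : ℕ → ℝ, (∀ j ∈ Finset.Icc 1 p, 0 ≤ lam j) →
    ∀ k : ℕ, 1 ≤ k →
      ‖∑ j ∈ Finset.Icc 1 p, (lam j : 𝕜) • x (j + k)‖
        ≤ c * ‖∑ j ∈ Finset.Icc 1 p, (lam j : 𝕜) • x j‖

/-- The average `(1 / (b - a + 1)) ∑_{k=a}^b |⟨x*, x_k⟩|`, where `b - a + 1` is computed in `ℝ`. -/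
def absAverage {𝕜 X : Type*} [RCLike 𝕜] [NormedAddCommGroup X] [NormedSpace 𝕜 X]
    (x : ℕ → X) (f : StrongDual 𝕜 X) (a b : ℕ) : ℝ :=
  (1 / ((b : ℝ) - (a : ℝ) + 1)) * ∑ k ∈ Finset.Icc a b, ‖f (x k)‖

/-- The supremum of these averages over the closed unit ball of the dual. For `a ≤ b` it is taken
over a non-empty set bounded above by the average of the norms `‖x_k‖`. -/
def supAbsAverage (𝕜 : Type*) {X : Type*} [RCLike 𝕜] [NormedAddCommGroup X] [NormedSpace 𝕜 X]
    (x : ℕ → X) (a b : ℕ) : ℝ :=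
  sSup {r : ℝ | ∃ f : StrongDual 𝕜 X, ‖f‖ ≤ 1 ∧ r = absAverage x f a b}

/-- Weak mixing to zero. -/
def WeaklyMixingToZero (𝕜 : Type*) {X : Type*} [RCLike 𝕜] [NormedAddCommGroup X]
    [NormedSpace 𝕜 X] (x : ℕ → X) : Prop :=
  ∀ f : StrongDual 𝕜 X, Tendsto (fun n : ℕ => absAverage x f 1 n) atTop (𝓝 0)

/-- Uniformly weak mixing to zero. -/
def UniformlyWeaklyMixingToZero (𝕜 : Type*) {X : Type*} [RCLike 𝕜] [NormedAddCommGroup X]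
    [NormedSpace 𝕜 X] (x : ℕ → X) : Prop :=
  Tendsto (fun n : ℕ => supAbsAverage 𝕜 x 1 n) atTop (𝓝 0)

/-- The filter on pairs `(a, b)` of integers `a, b ≥ 1` expressing `b - a → ∞`. -/
def longIntervals : Filter (ℕ × ℕ) :=
  comap (fun p : ℕ × ℕ => (p.2 : ℤ) - (p.1 : ℤ)) atTop ⊓ 𝓟 {p : ℕ × ℕ | 1 ≤ p.1 ∧ 1 ≤ p.2}

/-- The averages over `[a, b]` tend to zero as `b - a → ∞`, uniformly on the dual unit ball. -/
def BanachUniformlyWeaklyMixingToZero (𝕜 : Type*) {X : Type*} [RCLike 𝕜] [NormedAddCommGroup X]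
    [NormedSpace 𝕜 X] (x : ℕ → X) : Prop :=
  Tendsto (fun p : ℕ × ℕ => supAbsAverage 𝕜 x p.1 p.2) longIntervals (𝓝 0)

end

/-! Only (i) ⇒ (iii) is substantial. On the weak* compact dual ball the functions `s ↦ ‖s (x j)‖`
are continuous, bounded, and have Cesàro means tending pointwise to zero. Hahn–Banach separation,
Riesz representation and dominated convergence then give one convex combination that is uniformly
small (`exists_convex_combination_lt`).

Convex shift-boundedness carries this smallness to every shift at the cost of a factor `4c`
(`sum_mul_norm_shift_le`). A sum over a long window differs from the weighted average of its shifts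
by at most `p * M`, so averages over all long windows are small, wherever they start. -/

open MeasureTheory CompactlySupported in
/-- Bounded nonnegative continuous functions on a compact space whose Cesàro means tend to zero
pointwise have finite convex combinations that are uniformly small. -/
theorem exists_convex_combination_lt {K : Type*} [TopologicalSpace K] [CompactSpace K] [T2Space K]
    (g : ℕ → C(K, ℝ)) (M : ℝ) (hM : ∀ j, 1 ≤ j → ∀ s, |g j s| ≤ M)
    (hg : ∀ s, Tendsto (fun n : ℕ => (1 / (n : ℝ)) * ∑ j ∈ Finset.Icc 1 n, g j s) atTop (𝓝 0))
    {ε : ℝ} (hε : 0 < ε) :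
    ∃ p : ℕ, 1 ≤ p ∧ ∃ lam : ℕ → ℝ, (∀ j, 0 ≤ lam j) ∧ ∑ j ∈ Finset.Icc 1 p, lam j = 1 ∧
      ∀ s, ∑ j ∈ Finset.Icc 1 p, lam j * g j s < ε := by
  -- Finitely supported probability weights on the indices `≥ 1`; the `linearCombination` is the
  -- total mass.
  let W : Set (ℕ →₀ ℝ) :=
    {l | (∀ j, 0 ≤ l j) ∧ Finsupp.linearCombination ℝ (fun _ => (1 : ℝ)) l = 1 ∧ l 0 = 0}
  have hW : Convex ℝ W := by
    rintro l ⟨h1, h2, h3⟩ m ⟨k1, k2, k3⟩ a b ha hb hab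
    refine ⟨fun j => ?_, ?_, ?_⟩
    · have := mul_nonneg ha (h1 j)
      have := mul_nonneg hb (k1 j)
      simp only [Finsupp.add_apply, Finsupp.smul_apply, smul_eq_mul]
      linarith
    · rw [map_add, map_smul, map_smul, h2, k2]
      simpa using hab
    · simp [h3, k3]
  let T := Finsupp.linearCombination ℝ g
  let U : Set C(K, ℝ) := {h | Set.MapsTo h Set.univ (Set.Iio ε)}
  have hUo : IsOpen U := ContinuousMap.isOpen_setOfPred_mapsTo isCompact_univ isOpen_Iio
  have hUc : Convex ℝ U := by
    intro h1 H1 h2 H2 a b ha hb hab s _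
    have := convex_Iio ε (H1 (Set.mem_univ s)) (H2 (Set.mem_univ s)) ha hb hab
    simpa using this
  by_cases hdis : Disjoint U (T '' W)
  · exfalso
    obtain ⟨φ, u, hφU, hφW⟩ := geometric_hahn_banach_open hUc hUo (hW.linear_image T) hdis
    have hu : 0 < u := by
      have := hφU 0 (fun s _ => by simpa using hε)
      simpa using this
    -- `U` contains `-t • h` for all `t > 0`; if `φ h < 0`, then `t = u / (-φ h)` gives `φ (-t • h)
    -- = u`, contradicting `φ < u` on `U`.
    have hpos : ∀ h : C(K, ℝ), (∀ s, 0 ≤ h s) → 0 ≤ φ h := by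
      intro h hh
      by_contra! hneg
      have ht : 0 < u / (-φ h) := div_pos hu (by linarith)
      have := hφU (-(u / (-φ h)) • h) (fun s _ => by
        have := mul_nonneg ht.le (hh s)
        simp only [ContinuousMap.coe_smul, Pi.smul_apply, smul_eq_mul, Set.mem_Iio]
        linarith)
      rw [map_smul, smul_eq_mul] at this
      have h3 : -(u / (-φ h)) * φ h = u := by
        have : φ h ≠ 0 := hneg.ne
        field_simp
      linarith
    have hφg : ∀ j, 1 ≤ j → u ≤ φ (g j) := by
      intro j hj
      refine hφW _ ⟨Finsupp.single j 1, ⟨fun i => ?_, ?_, ?_⟩, ?_⟩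
      · rw [Finsupp.single_apply]; split_ifs <;> norm_num
      · simp
      · rw [Finsupp.single_apply, if_neg (by omega)]
      · simp [T]
    let _ : MeasurableSpace K := borel K
    have : BorelSpace K := ⟨rfl⟩
    let Λ : C_c(K, ℝ) →ₚ[ℝ] ℝ := PositiveLinearMap.mk₀
      { toFun := fun f => φ f.toContinuousMap
        map_add' := fun f h => map_add φ f.toContinuousMap h.toContinuousMap
        map_smul' := fun c f => map_smul φ c f.toContinuousMap }
      (fun f hf => hpos _ hf)
    let μ := RealRMK.rieszMeasure Λ
    have hμ : ∀ h : C(K, ℝ), ∫ s, h s ∂μ = φ h := fun h =>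
      RealRMK.integral_rieszMeasure Λ (CompactlySupportedContinuousMap.continuousMapEquiv h)
    let avg : ℕ → C(K, ℝ) := fun n => (1 / (n : ℝ)) • ∑ j ∈ Finset.Icc 1 n, g j
    have havg : ∀ n s, avg n s = (1 / (n : ℝ)) * ∑ j ∈ Finset.Icc 1 n, g j s := by
      intro n s
      simp [avg, ContinuousMap.coe_sum]
    have hlim : Tendsto (fun n => ∫ s, avg n s ∂μ) atTop (𝓝 (∫ _, (0 : ℝ) ∂μ)) := by
      refine tendsto_integral_of_dominated_convergence (fun _ => |M|)
        (fun n => (avg n).continuous.aestronglyMeasurable) (integrable_const _)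
        (fun n => Eventually.of_forall fun s => ?_)
        (Eventually.of_forall fun s => by simpa only [havg] using hg s)
      rw [havg, Real.norm_eq_abs, abs_mul]
      rcases Nat.eq_zero_or_pos n with rfl | hn
      · simp
      · have hn' : (0 : ℝ) < n := by exact_mod_cast hn
        have h1 : |∑ j ∈ Finset.Icc 1 n, g j s| ≤ n * M := by
          refine (Finset.abs_sum_le_sum_abs _ _).trans ?_
          refine (Finset.sum_le_card_nsmul _ _ M
            (fun j hj => hM j (Finset.mem_Icc.1 hj).1 s)).trans ?_
          simp
        rw [abs_of_pos (by positivity), one_div, inv_mul_le_iff₀ hn']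
        exact h1.trans (mul_le_mul_of_nonneg_left (le_abs_self M) hn'.le)
    rw [integral_zero] at hlim
    -- The integrals of the Cesàro means tend to `0`, yet each is an average of values `φ (g j) ≥ u
    -- > 0`.
    refine absurd (ge_of_tendsto hlim ?_) (not_le.2 hu)
    filter_upwards [eventually_ge_atTop 1] with n hn
    have hn' : (0 : ℝ) < n := by exact_mod_cast hn
    rw [hμ, map_smul, map_sum, smul_eq_mul, one_div, le_inv_mul_iff₀ hn']
    have := Finset.card_nsmul_le_sum (Finset.Icc 1 n) (fun j => φ (g j)) u
      (fun j hj => hφg j (Finset.mem_Icc.1 hj).1)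
    simpa using this
  · obtain ⟨_, hU, l, ⟨h1, h2, h3⟩, rfl⟩ := Set.not_disjoint_iff.1 hdis
    have hsub : l.support ⊆ Finset.Icc 1 (l.support.sup id + 1) := by
      intro j hj
      rw [Finset.mem_Icc]
      constructor
      · rcases Nat.eq_zero_or_pos j with rfl | h
        · exact absurd h3 (Finsupp.mem_support_iff.1 hj)
        · exact h
      · exact (Finset.le_sup (f := id) hj).trans (Nat.le_succ _)
    refine ⟨l.support.sup id + 1, by omega, l, h1, ?_, fun s => ?_⟩
    · rw [← h2, Finsupp.linearCombination_apply, Finsupp.sum]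
      simp only [smul_eq_mul, mul_one]
      exact (Finset.sum_subset hsub fun j _ hj => by simpa using hj).symm
    · have h4 := hU (Set.mem_univ s)
      rw [Finsupp.linearCombination_apply, Finsupp.sum, Set.mem_Iio, ContinuousMap.coe_sum,
        Finset.sum_apply] at h4
      refine lt_of_eq_of_lt ?_ h4
      refine (Finset.sum_subset hsub fun j _ hj => ?_).symm
      have : l j = 0 := by simpa using hj
      simp [this]

/-! ### Uniform smallness along shifts and windows -/

section

variable {𝕜 : Type*} [RCLike 𝕜] {X : Type*} [NormedAddCommGroup X] [NormedSpace 𝕜 X]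

/-- A convex shift-bounded sequence is bounded. -/
theorem ConvexShiftBounded.exists_norm_le {x : ℕ → X} (hx : ConvexShiftBounded 𝕜 x) :
    ∃ M : ℝ, 0 ≤ M ∧ ∀ k, 1 ≤ k → ‖x k‖ ≤ M := by
  obtain ⟨c, hc, h⟩ := hx
  refine ⟨max ‖x 1‖ (c * ‖x 1‖), le_max_of_le_left (norm_nonneg _), fun k hk => ?_⟩
  rcases Nat.lt_or_ge 1 k with hk1 | hk1
  · have := h 1 le_rfl (fun _ => 1) (fun _ _ => zero_le_one) (k - 1) (by omega)
    simp only [Finset.Icc_self, Finset.sum_singleton, RCLike.ofReal_one, one_smul] at this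
    rw [show 1 + (k - 1) = k by omega] at this
    exact this.trans (le_max_right _ _)
  · rw [show k = 1 by omega]
    exact le_max_left _ _

/-- Convex shift-boundedness passes from norms of nonnegative combinations to
`sup_{‖f‖ ≤ 1} ∑ λ_j |f(x_j)|`, with constant `4c`. -/
theorem sum_mul_norm_shift_le {x : ℕ → X} {c : ℝ} (hc : 0 < c)
    (hx : ∀ p : ℕ, 1 ≤ p → ∀ lam : ℕ → ℝ, (∀ j ∈ Finset.Icc 1 p, 0 ≤ lam j) →
      ∀ k : ℕ, 1 ≤ k → ‖∑ j ∈ Finset.Icc 1 p, (lam j : 𝕜) • x (j + k)‖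
        ≤ c * ‖∑ j ∈ Finset.Icc 1 p, (lam j : 𝕜) • x j‖)
    {p : ℕ} (hp : 1 ≤ p) {lam : ℕ → ℝ} (hlam : ∀ j, 0 ≤ lam j) {ε : ℝ}
    (hε : ∀ f : StrongDual 𝕜 X, ‖f‖ ≤ 1 → ∑ j ∈ Finset.Icc 1 p, lam j * ‖f (x j)‖ ≤ ε)
    {k : ℕ} (hk : 1 ≤ k) {f : StrongDual 𝕜 X} (hf : ‖f‖ ≤ 1) :
    ∑ j ∈ Finset.Icc 1 p, lam j * ‖f (x (j + k))‖ ≤ 4 * (c * ε) := by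
  -- Discarding the weights outside `A` only decreases `∑ λ_j |g(x_j)|`, here applied to a norming
  -- functional `g` of the unshifted sum.
  have hsub : ∀ (A : ℕ → Prop) [DecidablePred A],
      ‖∑ j ∈ Finset.Icc 1 p, ((if A j then lam j else 0 : ℝ) : 𝕜) • x (j + k)‖ ≤ c * ε := by
    intro A _
    refine (hx p hp _ (fun j _ => ?_) k hk).trans (mul_le_mul_of_nonneg_left ?_ hc.le)
    · split_ifs
      exacts [hlam j, le_rfl]
    obtain ⟨g, hg1, hg⟩ := exists_dual_vector'' 𝕜
      (∑ j ∈ Finset.Icc 1 p, ((if A j then lam j else 0 : ℝ) : 𝕜) • x j)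
    have hn : ‖∑ j ∈ Finset.Icc 1 p, ((if A j then lam j else 0 : ℝ) : 𝕜) • x j‖ =
        ‖g (∑ j ∈ Finset.Icc 1 p, ((if A j then lam j else 0 : ℝ) : 𝕜) • x j)‖ := by
      rw [hg, RCLike.norm_ofReal, abs_norm]
    rw [hn, map_sum]
    refine (norm_sum_le _ _).trans ((Finset.sum_le_sum fun j _ => ?_).trans (hε g hg1))
    rw [map_smul, norm_smul, RCLike.norm_ofReal]
    refine mul_le_mul_of_nonneg_right ?_ (norm_nonneg _)
    split_ifs
    · exact (abs_of_nonneg (hlam j)).le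
    · simpa using hlam j
  have hreal : ∀ r : 𝕜 →ₗ[ℝ] ℝ, (∀ z, |r z| ≤ ‖z‖) →
      ∑ j ∈ Finset.Icc 1 p, lam j * |r (f (x (j + k)))| ≤ 2 * (c * ε) := by
    intro r hr
    have key : ∀ (A : ℕ → Prop) [DecidablePred A],
        |∑ j ∈ Finset.Icc 1 p, (if A j then lam j else 0) * r (f (x (j + k)))| ≤ c * ε := by
      intro A _
      have h1 : ∑ j ∈ Finset.Icc 1 p, (if A j then lam j else 0) * r (f (x (j + k))) =
          r (f (∑ j ∈ Finset.Icc 1 p, ((if A j then lam j else 0 : ℝ) : 𝕜) • x (j + k))) := by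
        rw [map_sum, map_sum]
        refine Finset.sum_congr rfl fun j _ => ?_
        rw [map_smul, smul_eq_mul, ← RCLike.real_smul_eq_coe_mul, map_smul, smul_eq_mul]
      rw [h1]
      refine (hr _).trans ((f.le_of_opNorm_le hf _).trans ?_)
      rw [one_mul]
      exact hsub A
    -- Splitting by sign costs a factor 2; real and imaginary parts cost another, whence the 4.
    have h2 : ∑ j ∈ Finset.Icc 1 p, lam j * |r (f (x (j + k)))| =
        ∑ j ∈ Finset.Icc 1 p,
          (if 0 ≤ r (f (x (j + k))) then lam j else 0) * r (f (x (j + k))) -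
        ∑ j ∈ Finset.Icc 1 p,
          (if ¬ 0 ≤ r (f (x (j + k))) then lam j else 0) * r (f (x (j + k))) := by
      rw [← Finset.sum_sub_distrib]
      refine Finset.sum_congr rfl fun j _ => ?_
      by_cases h : 0 ≤ r (f (x (j + k)))
      · simp [h, abs_of_nonneg h]
      · simp [h, abs_of_neg (not_le.1 h)]
    rw [h2]
    have h3 := (abs_le.1 (key fun j => 0 ≤ r (f (x (j + k))))).2
    have h4 := (abs_le.1 (key fun j => ¬ 0 ≤ r (f (x (j + k))))).1
    linarith
  have hre := hreal RCLike.reLm RCLike.abs_re_le_norm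
  have him := hreal RCLike.imLm RCLike.abs_im_le_norm
  have hsum : ∑ j ∈ Finset.Icc 1 p, lam j * ‖f (x (j + k))‖ ≤
      ∑ j ∈ Finset.Icc 1 p, lam j * |RCLike.reLm (f (x (j + k)))| +
      ∑ j ∈ Finset.Icc 1 p, lam j * |RCLike.imLm (f (x (j + k)))| := by
    rw [← Finset.sum_add_distrib]
    refine Finset.sum_le_sum fun j _ => ?_
    rw [← mul_add]
    refine mul_le_mul_of_nonneg_left ?_ (hlam j)
    have h := norm_add_le ((RCLike.re (f (x (j + k))) : ℝ) : 𝕜)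
      ((RCLike.im (f (x (j + k))) : ℝ) * RCLike.I)
    rw [RCLike.re_add_im, norm_mul, RCLike.norm_ofReal, RCLike.norm_ofReal] at h
    exact h.trans (add_le_add le_rfl
      (mul_le_of_le_one_right (abs_nonneg _) (by rw [RCLike.norm_I]; split_ifs <;> norm_num)))
  linarith

/-- Shifting a window by `j` changes the sum of a function with values in `[0, M]` by at most
`j M`. -/
theorem sum_Icc_le_add_sum_shift {h : ℕ → ℝ} {M : ℝ} (h0 : ∀ k, 0 ≤ h k)
    {a : ℕ} (hM : ∀ k, a ≤ k → h k ≤ M) (b j : ℕ) :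
    ∑ k ∈ Finset.Icc a b, h k ≤ j * M + ∑ k ∈ Finset.Icc a b, h (j + k) := by
  have hsub : Finset.Icc a b ⊆
      Finset.Ico a (a + j) ∪ (Finset.Icc a b).image (fun k => j + k) := by
    intro k hk
    rw [Finset.mem_Icc] at hk
    simp only [Finset.mem_union, Finset.mem_Ico, Finset.mem_image, Finset.mem_Icc]
    rcases Nat.lt_or_ge k (a + j) with h | h
    · exact Or.inl ⟨hk.1, h⟩
    · exact Or.inr ⟨k - j, by omega, by omega⟩
  calc ∑ k ∈ Finset.Icc a b, h k
      ≤ ∑ k ∈ Finset.Ico a (a + j) ∪ (Finset.Icc a b).image (fun k => j + k), h k :=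
        Finset.sum_le_sum_of_subset_of_nonneg hsub fun k _ _ => h0 k
    _ ≤ ∑ k ∈ Finset.Ico a (a + j), h k + ∑ k ∈ (Finset.Icc a b).image (fun k => j + k), h k := by
        rw [← Finset.sum_union_inter]
        exact le_add_of_nonneg_right (Finset.sum_nonneg fun k _ => h0 k)
    _ ≤ j * M + ∑ k ∈ Finset.Icc a b, h (j + k) := by
        refine add_le_add ?_ (le_of_eq ?_)
        · refine (Finset.sum_le_card_nsmul _ _ M
            (fun k hk => hM k (Finset.mem_Ico.1 hk).1)).trans ?_
          simp
        · exact Finset.sum_image fun k _ l _ hkl => Nat.add_left_cancel hkl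

/-- A weakly mixing sequence bounded by `M` has nonnegative weights of sum one for which
`∑ λ_j |f(x_j)|` is small uniformly on the dual unit ball. -/
theorem WeaklyMixingToZero.exists_weights {x : ℕ → X} (hx : WeaklyMixingToZero 𝕜 x) {M : ℝ}
    (hM : ∀ k, 1 ≤ k → ‖x k‖ ≤ M) {ε : ℝ} (hε : 0 < ε) :
    ∃ p : ℕ, 1 ≤ p ∧ ∃ lam : ℕ → ℝ, (∀ j, 0 ≤ lam j) ∧ ∑ j ∈ Finset.Icc 1 p, lam j = 1 ∧
      ∀ f : StrongDual 𝕜 X, ‖f‖ ≤ 1 → ∑ j ∈ Finset.Icc 1 p, lam j * ‖f (x j)‖ ≤ ε := by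
  let B : Set (WeakDual 𝕜 X) := WeakDual.toStrongDual ⁻¹' Metric.closedBall 0 1
  have : CompactSpace B := isCompact_iff_compactSpace.1 (WeakDual.isCompact_closedBall 0 1)
  let g : ℕ → C(B, ℝ) := fun j =>
    ⟨fun s => ‖s.1 (x j)‖, ((WeakDual.eval_continuous (x j)).comp continuous_subtype_val).norm⟩
  have hgM : ∀ j, 1 ≤ j → ∀ s, |g j s| ≤ M := by
    intro j hj s
    have hs : ‖WeakDual.toStrongDual s.1‖ ≤ 1 := mem_closedBall_zero_iff.1 s.2
    change |‖(WeakDual.toStrongDual s.1) (x j)‖| ≤ M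
    rw [abs_norm]
    refine ((WeakDual.toStrongDual s.1).le_of_opNorm_le hs _).trans ?_
    rw [one_mul]
    exact hM j hj
  obtain ⟨p, hp, lam, h0, h1, h2⟩ := exists_convex_combination_lt g M hgM (fun s => by
    have := hx (WeakDual.toStrongDual s.1)
    simp only [absAverage, Nat.cast_one, sub_add_cancel] at this
    exact this) hε
  refine ⟨p, hp, lam, h0, h1, fun f hf => ?_⟩
  exact (h2 ⟨StrongDual.toWeakDual f, by simpa [B] using hf⟩).le

/-- Allowing `a = b + 1` covers the empty window `[1, 0]`, where `1 / 0 = 0`, so no case `n = 0` has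
to be excluded later. -/
theorem absAverage_le_supAbsAverage (x : ℕ → X) {f : StrongDual 𝕜 X} (hf : ‖f‖ ≤ 1) {a b : ℕ}
    (hab : a ≤ b + 1) : absAverage x f a b ≤ supAbsAverage 𝕜 x a b := by
  have hpos : (0 : ℝ) ≤ 1 / ((b : ℝ) - a + 1) := by
    have : (a : ℝ) ≤ b + 1 := by exact_mod_cast hab
    exact div_nonneg zero_le_one (by linarith)
  refine le_csSup ⟨(1 / ((b : ℝ) - a + 1)) * ∑ k ∈ Finset.Icc a b, ‖x k‖, ?_⟩ ⟨f, hf, rfl⟩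
  rintro _ ⟨g, hg, rfl⟩
  refine mul_le_mul_of_nonneg_left (Finset.sum_le_sum fun k _ => ?_) hpos
  simpa using g.le_of_opNorm_le hg (x k)

theorem absAverage_nonneg (x : ℕ → X) (f : StrongDual 𝕜 X) {a b : ℕ}
    (hab : a ≤ b + 1) : 0 ≤ absAverage x f a b := by
  have : (a : ℝ) ≤ b + 1 := by exact_mod_cast hab
  exact mul_nonneg (div_nonneg zero_le_one (by linarith))
    (Finset.sum_nonneg fun k _ => norm_nonneg _)

theorem absAverage_smul (x : ℕ → X) (c : 𝕜) (f : StrongDual 𝕜 X) (a b : ℕ) :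
    absAverage x (c • f) a b = ‖c‖ * absAverage x f a b := by
  simp only [absAverage, smul_apply, norm_smul, ← Finset.mul_sum]
  ring

theorem UniformlyWeaklyMixingToZero.weaklyMixingToZero {x : ℕ → X}
    (hx : UniformlyWeaklyMixingToZero 𝕜 x) : WeaklyMixingToZero 𝕜 x := by
  intro f
  -- Scaling by `(‖f‖ + 1)⁻¹` puts `f` in the unit ball, even when `f = 0`.
  have hpos : (0 : ℝ) < ‖f‖ + 1 := by positivity
  have hlim := Tendsto.const_mul (‖f‖ + 1) hx
  rw [mul_zero] at hlim
  refine squeeze_zero (fun n => absAverage_nonneg x f (by omega)) (fun n => ?_) hlim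
  have hnorm : ‖(((‖f‖ + 1)⁻¹ : ℝ) : 𝕜)‖ = (‖f‖ + 1)⁻¹ := by
    rw [RCLike.norm_ofReal, abs_of_pos (inv_pos.2 hpos)]
  have h1 : ‖(((‖f‖ + 1)⁻¹ : ℝ) : 𝕜) • f‖ ≤ 1 := by
    rw [norm_smul, hnorm, inv_mul_le_iff₀ hpos]
    linarith
  have h2 := absAverage_le_supAbsAverage x h1 (show 1 ≤ n + 1 by omega)
  rwa [absAverage_smul, hnorm, inv_mul_le_iff₀ hpos] at h2

theorem BanachUniformlyWeaklyMixingToZero.uniformlyWeaklyMixingToZero {x : ℕ → X}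
    (hx : BanachUniformlyWeaklyMixingToZero 𝕜 x) : UniformlyWeaklyMixingToZero 𝕜 x := by
  refine Tendsto.comp (f := fun n : ℕ => (1, n)) hx ?_
  refine tendsto_inf.2 ⟨tendsto_comap_iff.2 ?_, tendsto_principal.2 ?_⟩
  · exact tendsto_atTop_add_const_right atTop (-1 : ℤ) tendsto_natCast_atTop_atTop
  · filter_upwards [eventually_ge_atTop 1] with n hn
    exact ⟨le_rfl, hn⟩

theorem ConvexShiftBounded.banachUniformlyWeaklyMixingToZero {x : ℕ → X}
    (hx : ConvexShiftBounded 𝕜 x) (hmix : WeaklyMixingToZero 𝕜 x) :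
    BanachUniformlyWeaklyMixingToZero 𝕜 x := by
  obtain ⟨M, hM0, hM⟩ := hx.exists_norm_le
  obtain ⟨c, hc, hx⟩ := hx
  refine Metric.tendsto_nhds.2 fun ε hε => ?_
  -- After the factor `4c` the shifted sums contribute `ε / 4`; a window with `b - a ≥ 4pM/ε` makes
  -- the boundary error another `ε / 4`.
  obtain ⟨p, hp, lam, hlam, hsum, hsmall⟩ :=
    hmix.exists_weights hM (show 0 < ε / (16 * c) by positivity)
  have h4 : 4 * (c * (ε / (16 * c))) = ε / 4 := by
    field_simp
    norm_num
  have hlong : ∀ᶠ q in longIntervals, ((⌈4 * (p * M) / ε⌉₊ : ℕ) : ℤ) ≤ (q.2 : ℤ) - q.1 ∧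
      (1 ≤ q.1 ∧ 1 ≤ q.2) :=
    ((tendsto_comap.eventually (eventually_ge_atTop _)).filter_mono inf_le_left).and
      ((eventually_principal.2 fun q hq => hq).filter_mono inf_le_right)
  filter_upwards [hlong] with q hq
  obtain ⟨a, b⟩ := q
  obtain ⟨hq, ha, -⟩ := hq
  simp only at hq ha
  have hab : a ≤ b := by omega
  have hN : 4 * (p * M) / ε ≤ (b : ℝ) - a := by
    refine (Nat.le_ceil _).trans ?_
    exact_mod_cast hq
  have hab' : (0 : ℝ) < (b : ℝ) - a + 1 := by
    have : (a : ℝ) ≤ b := by exact_mod_cast hab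
    linarith
  have hbound : ∀ f : StrongDual 𝕜 X, ‖f‖ ≤ 1 → absAverage x f a b ≤ ε / 2 := by
    intro f hf
    have hfM : ∀ k, a ≤ k → ‖f (x k)‖ ≤ M := fun k hk => by
      refine (f.le_of_opNorm_le hf _).trans ?_
      rw [one_mul]
      exact hM k (ha.trans hk)
    have hS : ∑ k ∈ Finset.Icc a b, ‖f (x k)‖ ≤ p * M + ((b : ℝ) - a + 1) * (ε / 4) := by
      calc ∑ k ∈ Finset.Icc a b, ‖f (x k)‖
          = ∑ j ∈ Finset.Icc 1 p, lam j * ∑ k ∈ Finset.Icc a b, ‖f (x k)‖ := by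
            rw [← Finset.sum_mul, hsum, one_mul]
        _ ≤ ∑ j ∈ Finset.Icc 1 p,
              lam j * (p * M + ∑ k ∈ Finset.Icc a b, ‖f (x (j + k))‖) := by
            refine Finset.sum_le_sum fun j hj => mul_le_mul_of_nonneg_left ?_ (hlam j)
            refine (sum_Icc_le_add_sum_shift (h := fun k => ‖f (x k)‖)
              (fun k => norm_nonneg _) hfM b j).trans ?_
            gcongr
            exact (Finset.mem_Icc.1 hj).2
        _ = p * M + ∑ k ∈ Finset.Icc a b,
              ∑ j ∈ Finset.Icc 1 p, lam j * ‖f (x (j + k))‖ := by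
            simp only [mul_add, Finset.sum_add_distrib, ← Finset.sum_mul, hsum, one_mul]
            rw [Finset.sum_comm]
            simp only [Finset.mul_sum]
        _ ≤ p * M + ((b : ℝ) - a + 1) * (ε / 4) := by
            gcongr
            refine (Finset.sum_le_card_nsmul _ _ (ε / 4) fun k hk => ?_).trans_eq ?_
            · rw [← h4]
              exact sum_mul_norm_shift_le hc hx hp hlam hsmall
                (ha.trans (Finset.mem_Icc.1 hk).1) hf
            · rw [Nat.card_Icc, nsmul_eq_mul, Nat.cast_sub (by omega)]
              push_cast
              ring
    rw [absAverage, one_div, inv_mul_le_iff₀ hab']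
    rw [div_le_iff₀ hε] at hN
    nlinarith
  have hle : supAbsAverage 𝕜 x a b ≤ ε / 2 := by
    refine csSup_le ⟨_, 0, by simp, rfl⟩ ?_
    rintro _ ⟨f, hf, rfl⟩
    exact hbound f hf
  have hge : 0 ≤ supAbsAverage 𝕜 x a b :=
    (absAverage_nonneg x 0 (by omega)).trans
      (absAverage_le_supAbsAverage x (f := (0 : StrongDual 𝕜 X)) (by simp) (by omega))
  rw [Real.dist_eq, sub_zero, abs_of_nonneg hge]
  linarith

end

theorem theorem5p2 {𝕜 : Type*} [RCLike 𝕜] {X : Type*} [NormedAddCommGroup X] [NormedSpace 𝕜 X]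
    [CompleteSpace X] (x : ℕ → X) (hx : ConvexShiftBounded 𝕜 x) :
    List.TFAE [WeaklyMixingToZero 𝕜 x, UniformlyWeaklyMixingToZero 𝕜 x,
      BanachUniformlyWeaklyMixingToZero 𝕜 x] := by
  tfae_have 1 → 3 := hx.banachUniformlyWeaklyMixingToZero
  tfae_have 3 → 2 := fun h => h.uniformlyWeaklyMixingToZero
  tfae_have 2 → 1 := fun h => h.weaklyMixingToZero
  tfae_finish
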